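/- Let $(W,S)$ be a Coxeter system of rank $|S|\ge 3$ ($S$ may be infinite), let $\ell$ be the length function on $W$ with respect to $S$, and let $W^+=\{w\in W : \ell(w)\text{ is even}\}$ be the alternating subgroup of $W$. Then the centre of $W^+$ is contained in the centre of $W$, that is, $Z(W^+)\subseteq Z(W)$. In particular, if $W$ is moreover infinite and $(W,S)$ is irreducible (its Coxeter graph is connected), then $Z(W^+)$ is trivial. -/

import Mathlib

/-- The alternating subgroup `W⁺` of a Coxeter system: the elements of even length with respect to
the simple reflections. -/
def CoxeterSystem.alternatingSubgroup {B W : Type*} [Group W] {M : CoxeterMatrix B}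
    (cs : CoxeterSystem M W) : Subgroup W where
  carrier := {w | Even (cs.length w)}
  one_mem' := by simp
  mul_mem' := by
    intro a b ha hb
    have h := cs.length_mul_mod_two a b
    simp only [Set.mem_ofPred_eq, Nat.even_iff] at *
    omega
  inv_mem' := by
    intro a ha
    simpa using ha

/-- The Coxeter graph of a Coxeter matrix: distinct `i`, `j` are joined if and only if
`M i j ≠ 2`, i.e. `M i j ≥ 3` or `M i j = ∞` (the latter is encoded as `M i j = 0`). -/
def CoxeterMatrix.coxeterGraph {B : Type*} (M : CoxeterMatrix B) : SimpleGraph B where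
  Adj i j := i ≠ j ∧ M i j ≠ 2
  symm := ⟨fun i j h => ⟨h.1.symm, by rw [M.symmetric j i]; exact h.2⟩⟩
  loopless := ⟨fun _ h => h.1 rfl⟩

/-- A Coxeter matrix (or a Coxeter system of that type) is irreducible if its Coxeter graph is
nonempty and connected. -/
def CoxeterMatrix.IsIrreducible {B : Type*} (M : CoxeterMatrix B) : Prop :=
  M.coxeterGraph.Connected

/-! An element `z` of the centre of `W⁺` commutes with every `s_i s_j`, so `z' = s_j z s_j` does not
depend on `j`. Suppose `z' ≠ z`. By the exchange property each `j` is a left or a right descent of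
`z` but not both, as otherwise the lengths of `z` and `z'` differ by two, which a descent of the
shorter or longer one contradicts. Two distinct indices cannot lie on the same side, so there are at
most two indices. Hence `z` commutes with every `s_i` when the rank is at least three.

For `W` infinite and irreducible, the inversion parity of a central `z` is constant on conjugacy
classes. This spreads descents of `z` along edges of the Coxeter graph, so a nontrivial central `z`
has every index as a descent; it is then a longest element and `W` is finite. -/

namespace CoxeterMatrix

/-! ### Geometric representation -/

variable {B : Type*} (M : CoxeterMatrix B)

/-- The linear form `2 B(αᵢ, ·)` of the geometric representation. -/
noncomputable def simpleCoroot (i : B) : Module.Dual ℝ (B →₀ ℝ) :=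
  Finsupp.linearCombination ℝ fun j => -2 * Real.cos (Real.pi / M i j)

theorem simpleCoroot_single (i j : B) :
    M.simpleCoroot i (Finsupp.single j 1) = -2 * Real.cos (Real.pi / M i j) := by
  simp [simpleCoroot]

theorem simpleCoroot_single_self (i : B) : M.simpleCoroot i (Finsupp.single i 1) = 2 := by
  simp [simpleCoroot_single]

/-- The simple reflections of the geometric representation. -/
noncomputable def simpleReflection (i : B) : (B →₀ ℝ) ≃ₗ[ℝ] (B →₀ ℝ) :=
  Module.reflection (M.simpleCoroot_single_self i)

theorem simpleReflection_single (i j : B) :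
    M.simpleReflection i (Finsupp.single j 1) =
      Finsupp.single j 1 + (2 * Real.cos (Real.pi / M i j)) • Finsupp.single i 1 := by
  rw [simpleReflection, Module.reflection_apply, simpleCoroot_single]
  module

-- Powers of a product of two reflections are given by Chebyshev polynomials `S` at `2 cos θ`, `θ =
-- 2π/m`. The identity `S_n(2 cos θ) sin θ = sin((n+1)θ)` makes the needed coefficients vanish; `m =
-- 2` is separate because there `sin θ = 0`.
open Polynomial.Chebyshev in
theorem isLiftable_simpleReflection : M.IsLiftable M.simpleReflection := by
  intro i j
  have hdiag : ∀ i, M.simpleReflection i * M.simpleReflection i = 1 := fun i => by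
    ext1 x
    exact Module.involutive_reflection (M.simpleCoroot_single_self i) x
  rcases eq_or_ne i j with rfl | hij
  · simp [hdiag]
  have hfg : M.simpleCoroot i (Finsupp.single j 1) * M.simpleCoroot j (Finsupp.single i 1) - 2 =
      2 * Real.cos (2 * (Real.pi / M i j)) := by
    rw [simpleCoroot_single, simpleCoroot_single, M.symmetric j i, Real.cos_two_mul]
    ring
  have h1 := M.off_diagonal i j hij
  generalize hm : M i j = m at h1 hfg ⊢
  by_cases h0 : m = 0
  · simp [h0]
  by_cases h2 : m = 2
  · subst h2
    have hi : M.simpleCoroot i (Finsupp.single j 1) = 0 := by simp [simpleCoroot_single, hm]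
    have hj : M.simpleCoroot j (Finsupp.single i 1) = 0 := by
      simp [simpleCoroot_single, M.symmetric j i, hm]
    ext1 x
    simp only [pow_two, simpleReflection, LinearEquiv.mul_apply, Module.reflection_apply, map_sub,
      map_smul, hi, hj, simpleCoroot_single_self, LinearEquiv.coe_one, id_eq]
    module
  have hm3 : (3 : ℝ) ≤ m := by exact_mod_cast (by omega : 3 ≤ m)
  set θ : ℝ := 2 * (Real.pi / m) with hθ
  have hmθ : m * θ = 2 * Real.pi := by rw [hθ]; field_simp
  have hsin : Real.sin θ ≠ 0 := by
    refine (Real.sin_pos_of_pos_of_lt_pi (by positivity) ?_).ne'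
    have := Real.pi_pos
    rw [hθ, mul_div_assoc', div_lt_iff₀ (by linarith)]
    nlinarith
  have hS := fun n : ℤ => S_two_mul_real_cos θ n
  ext1 x
  rw [simpleReflection, simpleReflection,
    Module.reflection_mul_reflection_pow_apply _ _ _ _ _ hfg.symm]
  obtain ⟨k, rfl | rfl⟩ := m.even_or_odd'
  · have e1 : (((2 * k : ℕ) : ℤ) - 1) / 2 = k - 1 := by omega
    have e2 : (((2 * k : ℕ) : ℤ) - 2) / 2 = k - 1 := by omega
    have hk : (S ℝ (k - 1)).eval (2 * Real.cos θ) = 0 := by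
      refine (mul_eq_zero.mp ?_).resolve_right hsin
      rw [hS]
      push_cast at hmθ ⊢
      rw [show ((k : ℝ) - 1 + 1) * θ = Real.pi by linarith, Real.sin_pi]
    rw [e1, e2, hk]
    simp
  · have e1 : (((2 * k + 1 : ℕ) : ℤ) - 1) / 2 = k := by omega
    have e2 : (((2 * k + 1 : ℕ) : ℤ) - 2) / 2 = k - 1 := by omega
    have e3 : (((2 * k + 1 : ℕ) : ℤ) - 3) / 2 = k - 1 := by omega
    have e4 : (((2 * k + 1 : ℕ) : ℤ)) / 2 = k := by omega
    have hk : (S ℝ k).eval (2 * Real.cos θ) + (S ℝ (k - 1)).eval (2 * Real.cos θ) = 0 := by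
      refine (mul_eq_zero.mp ?_).resolve_right hsin
      rw [add_mul, hS, hS]
      push_cast at hmθ ⊢
      rw [show ((k : ℝ) + 1) * θ = 2 * Real.pi - (k - 1 + 1) * θ by linarith,
        Real.sin_two_pi_sub]
      ring
    rw [e1, e2, e3, e4, hk]
    simp

end CoxeterMatrix

namespace CoxeterSystem

variable {B W : Type*} [Group W] {M : CoxeterMatrix B} (cs : CoxeterSystem M W)

/-! ### Faithfulness facts read off the geometric representation -/

theorem simple_injective : Function.Injective cs.simple := by
  intro i j h
  by_contra hij
  have h' := congrArg (cs.lift ⟨_, M.isLiftable_simpleReflection⟩) h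
  rw [lift_apply_simple, lift_apply_simple] at h'
  have h2 := DFunLike.congr_fun (DFunLike.congr_fun h' (Finsupp.single i 1)) i
  simp [CoxeterMatrix.simpleReflection_single, Ne.symm hij] at h2

theorem eq_two_of_commute_simple {i j : B} (hij : i ≠ j)
    (h : Commute (cs.simple i) (cs.simple j)) : M i j = 2 := by
  have h' := congrArg (cs.lift ⟨_, M.isLiftable_simpleReflection⟩) h.eq
  rw [map_mul, map_mul, lift_apply_simple, lift_apply_simple] at h'
  -- With `c = cos(π / M i j)`, the `α_i`-coordinates of `σ_i σ_j α_j` and `σ_j σ_i α_j` are `-2c`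
  -- and `2c`, so `c = 0`.
  have h2 := DFunLike.congr_fun (DFunLike.congr_fun h' (Finsupp.single j 1)) i
  simp only [LinearEquiv.mul_apply, CoxeterMatrix.simpleReflection_single, map_add, map_smul] at h2
  simp [hij, M.symmetric j i] at h2
  have hcos : Real.cos (Real.pi / M i j) = 0 := by linarith
  have h1 := M.off_diagonal i j hij
  by_contra hne
  by_cases h0 : M i j = 0
  -- An infinite bond is `0`, and `π / 0 = 0` gives cosine `1`, as it should.
  · simp [h0] at hcos
  have hm3 : (3 : ℝ) ≤ M i j := by
    exact_mod_cast (by change M i j ≠ 1 at h1; omega : 3 ≤ M i j)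
  have := Real.pi_pos
  refine (Real.cos_pos_of_mem_Ioo ⟨?_, ?_⟩).ne' hcos
  · have : 0 < Real.pi / M i j := by positivity
    linarith
  · rw [div_lt_div_iff₀ (by linarith) (by norm_num)]
    nlinarith

/-! ### Inversion parity -/

open Classical in
/-- The action of a simple reflection on `W × ZMod 2` which conjugates the first coordinate and
changes the second one exactly at the simple reflection itself. -/
noncomputable def signedConj (i : B) : Function.End (W × ZMod 2) := fun p =>
  (cs.simple i * p.1 * cs.simple i, p.2 + if p.1 = cs.simple i then 1 else 0)

open Classical in
theorem signedConj_mul_pow_apply (i j : B) (k : ℕ) (t : W) (e : ZMod 2) :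
    ((cs.signedConj i * cs.signedConj j) ^ k) (t, e) =
      ((cs.simple i * cs.simple j) ^ k * t * ((cs.simple i * cs.simple j) ^ k)⁻¹,
        e + ∑ r ∈ Finset.range (2 * k),
          if t = cs.simple j * (cs.simple i * cs.simple j) ^ r then 1 else 0) := by
  have hb : SemiconjBy (cs.simple j) (cs.simple i * cs.simple j)
      (cs.simple i * cs.simple j)⁻¹ := by
    simp [SemiconjBy, mul_assoc]
  induction k with
  | zero => simp; rfl
  | succ k ih =>
    have hpow := (hb.pow_right k).eq
    rw [pow_succ']
    change cs.signedConj i (cs.signedConj j (((cs.signedConj i * cs.signedConj j) ^ k) (t, e))) = _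
    rw [ih, show 2 * (k + 1) = 2 * k + 1 + 1 by ring, Finset.sum_range_succ, Finset.sum_range_succ]
    have h1 : (cs.simple i * cs.simple j) ^ k * t * ((cs.simple i * cs.simple j) ^ k)⁻¹ =
        cs.simple j ↔ t = cs.simple j * (cs.simple i * cs.simple j) ^ (2 * k) := by
      rw [two_mul, pow_add, ← mul_assoc, hpow, inv_pow]
      generalize (cs.simple i * cs.simple j) ^ k = c
      exact ⟨fun h => by rw [← h]; group, fun h => by rw [h]; group⟩
    have h2 : cs.simple j * ((cs.simple i * cs.simple j) ^ k * t *
        ((cs.simple i * cs.simple j) ^ k)⁻¹) * cs.simple j = cs.simple i ↔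
        t = cs.simple j * (cs.simple i * cs.simple j) ^ (2 * k + 1) := by
      rw [show 2 * k + 1 = k + (1 + k) by ring, pow_add _ k (1 + k), pow_add, pow_one,
        ← mul_assoc (cs.simple j) (_ ^ k) (_ * _), hpow, inv_pow]
      generalize (cs.simple i * cs.simple j) ^ k = c
      constructor <;> intro h
      · rw [← h]
        simp [mul_assoc]
      · simp [h, mul_assoc]
    simp only [signedConj, h1, h2, Prod.mk.injEq]
    refine ⟨?_, by ring⟩
    rw [pow_succ']
    simp [mul_assoc]

/-- Over `2m` terms, those at `r` and `r + m` coincide and cancel modulo 2. -/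
theorem isLiftable_signedConj : M.IsLiftable cs.signedConj := by
  classical
  intro i j
  funext ⟨t, e⟩
  rw [signedConj_mul_pow_apply, simple_mul_simple_pow, two_mul, Finset.sum_range_add]
  simp only [pow_add, simple_mul_simple_pow, one_mul, inv_one, mul_one, CharTwo.add_self_eq_zero,
    add_zero]
  rfl

/-- The parity of the number of occurrences of `t` in the right inversion sequence of any word
for `w`. -/
noncomputable def inversionParity (w t : W) : ZMod 2 :=
  (cs.lift ⟨_, cs.isLiftable_signedConj⟩ w (t, 0)).2

open Classical in
theorem lift_signedConj_wordProd (ω : List B) (t : W) (e : ZMod 2) :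
    cs.lift ⟨_, cs.isLiftable_signedConj⟩ (cs.wordProd ω) (t, e) =
      (cs.wordProd ω * t * (cs.wordProd ω)⁻¹, e + ((cs.rightInvSeq ω).count t : ZMod 2)) := by
  induction ω with
  | nil => simp; rfl
  | cons i ω ih =>
    rw [wordProd_cons, map_mul, lift_apply_simple]
    change cs.signedConj i (cs.lift ⟨_, cs.isLiftable_signedConj⟩ (cs.wordProd ω) (t, e)) = _
    rw [ih, rightInvSeq, List.count_cons]
    have h : cs.wordProd ω * t * (cs.wordProd ω)⁻¹ = cs.simple i ↔
        (cs.wordProd ω)⁻¹ * cs.simple i * cs.wordProd ω = t := by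
      rw [mul_inv_eq_iff_eq_mul, mul_assoc, inv_mul_eq_iff_eq_mul, eq_comm]
    simp only [signedConj, h, beq_iff_eq, Prod.mk.injEq]
    refine ⟨by simp [mul_assoc], ?_⟩
    push_cast
    ring

open Classical in
theorem inversionParity_wordProd (ω : List B) (t : W) :
    cs.inversionParity (cs.wordProd ω) t = ((cs.rightInvSeq ω).count t : ZMod 2) := by
  rw [inversionParity, lift_signedConj_wordProd, zero_add]

theorem inversionParity_mul (x y t : W) :
    cs.inversionParity (x * y) t =
      cs.inversionParity y t + cs.inversionParity x (y * t * y⁻¹) := by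
  classical
  obtain ⟨ω, rfl⟩ := cs.wordProd_surjective x
  obtain ⟨ω', rfl⟩ := cs.wordProd_surjective y
  rw [inversionParity, map_mul]
  change (cs.lift ⟨_, cs.isLiftable_signedConj⟩ (cs.wordProd ω)
    (cs.lift ⟨_, cs.isLiftable_signedConj⟩ (cs.wordProd ω') (t, 0))).2 = _
  rw [lift_signedConj_wordProd, lift_signedConj_wordProd, inversionParity_wordProd,
    inversionParity_wordProd, zero_add]

open Classical in
theorem inversionParity_simple (i : B) (t : W) :
    cs.inversionParity (cs.simple i) t = if t = cs.simple i then 1 else 0 := by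
  rw [← wordProd_singleton, inversionParity_wordProd, rightInvSeq_singleton, wordProd_singleton]
  simp [List.count_singleton, eq_comm (a := t)]

theorem mem_rightInvSeq_of_inversionParity_eq_one {ω : List B} {t : W}
    (h : cs.inversionParity (cs.wordProd ω) t = 1) : t ∈ cs.rightInvSeq ω := by
  classical
  by_contra hn
  rw [inversionParity_wordProd, List.count_eq_zero_of_not_mem hn] at h
  simp at h

/-- Odd parity puts `s_i` in the inversion sequence of a reduced word. Conversely, passing from `w`
to `w s_i` flips the parity, and exactly one of the two has descent `i`. -/
theorem inversionParity_simple_eq_one_iff (w : W) (i : B) :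
    cs.inversionParity w (cs.simple i) = 1 ↔ cs.IsRightDescent w i := by
  have key : ∀ w : W, cs.inversionParity w (cs.simple i) = 1 → cs.IsRightDescent w i := by
    intro w h
    obtain ⟨ω, hω, rfl⟩ := cs.exists_isReduced w
    exact (cs.isRightInversion_simple_iff_isRightDescent _ i).mp
      (cs.isRightInversion_of_mem_rightInvSeq hω (cs.mem_rightInvSeq_of_inversionParity_eq_one h))
  refine ⟨key w, fun h => ?_⟩
  have h' := mt (key (w * cs.simple i)) (cs.isRightDescent_iff_not_isRightDescent_mul.mp h)
  rw [inversionParity_mul, inversionParity_simple, if_pos rfl] at h'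
  simp only [inv_simple, simple_mul_simple_cancel_right] at h'
  generalize cs.inversionParity w (cs.simple i) = a at h'
  revert a
  decide

/-! ### Exchange property and its consequences -/

theorem IsRightDescent.mem_rightInvSeq {ω : List B} {i : B}
    (h : cs.IsRightDescent (cs.wordProd ω) i) : cs.simple i ∈ cs.rightInvSeq ω :=
  cs.mem_rightInvSeq_of_inversionParity_eq_one ((cs.inversionParity_simple_eq_one_iff _ i).mpr h)

/-- The exchange property. -/
theorem IsRightDescent.exists_eraseIdx {ω : List B} {i : B}
    (h : cs.IsRightDescent (cs.wordProd ω) i) :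
    ∃ k < ω.length, cs.wordProd ω * cs.simple i = cs.wordProd (ω.eraseIdx k) := by
  obtain ⟨k, hk, hki⟩ := List.getElem_of_mem (h.mem_rightInvSeq cs)
  refine ⟨k, by simpa using hk, ?_⟩
  rw [← wordProd_mul_getD_rightInvSeq, List.getD_eq_getElem _ _ hk, hki]

/-- Exchange in the word `s_i ω` must delete the initial `s_i`: deleting a letter of `ω` would make
`w s_j` no longer than `w`. -/
theorem simple_mul_eq_mul_simple {w : W} {i j : B} (hi : ¬ cs.IsLeftDescent w i)
    (hj : ¬ cs.IsRightDescent w j)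
    (h : cs.length (cs.simple i * w * cs.simple j) ≠ cs.length w + 2) :
    cs.simple i * w = w * cs.simple j := by
  rw [not_isLeftDescent_iff] at hi
  rw [not_isRightDescent_iff] at hj
  obtain ⟨ω, hω, rfl⟩ := cs.exists_isReduced w
  have hd : cs.IsRightDescent (cs.wordProd (i :: ω)) j := by
    rcases cs.length_mul_simple (cs.wordProd (i :: ω)) j with h' | h'
    · rw [wordProd_cons] at h'
      omega
    · rw [isRightDescent_iff, h']
  obtain ⟨k, hk, hek⟩ := hd.exists_eraseIdx
  rw [wordProd_cons] at hek
  cases k with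
  | zero =>
    rw [List.eraseIdx_cons_zero] at hek
    conv_rhs => rw [← hek]
    simp
  | succ k =>
    rw [List.eraseIdx_cons_succ, wordProd_cons, mul_assoc, mul_right_inj] at hek
    have h1 := cs.length_wordProd_le (ω.eraseIdx k)
    rw [← hek, hj, hω.eq] at h1
    have := List.length_eraseIdx_le ω k
    omega

/-- In a reduced word ending in `j`, exchange for `i` cannot delete the last letter, since `s_i ≠
s_j`; so `w s_i` still has a word ending in `j`. -/
theorem length_mul_simple_mul_simple {w : W} {i j : B} (hij : i ≠ j) (hi : cs.IsRightDescent w i)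
    (hj : cs.IsRightDescent w j) :
    cs.length (w * cs.simple i * cs.simple j) + 2 = cs.length w := by
  rw [isRightDescent_iff] at hi
  obtain ⟨ω, hω, hw⟩ := cs.exists_isReduced (w * cs.simple j)
  have hw' : w = cs.wordProd (ω ++ [j]) := by
    rw [wordProd_append, ← hw]; simp
  have hjl := (cs.isRightDescent_iff).mp hj
  have hl : cs.length w = ω.length + 1 := by rw [← hjl, hw, hω.eq]
  have hi' : cs.IsRightDescent (cs.wordProd (ω ++ [j])) i := by
    rw [← hw', isRightDescent_iff, hi]
  obtain ⟨k, hk, hek⟩ := hi'.exists_eraseIdx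
  rw [← hw'] at hek
  rw [List.length_append, List.length_singleton] at hk
  rcases (Nat.lt_succ_iff.mp hk).lt_or_eq with hk | rfl
  · rw [List.eraseIdx_append_of_lt_length hk, wordProd_append, wordProd_singleton] at hek
    have h1 := cs.length_wordProd_le (ω.eraseIdx k)
    rw [List.length_eraseIdx_of_lt hk] at h1
    rw [hek, simple_mul_simple_cancel_right]
    rcases cs.length_mul_simple (w * cs.simple i) j with h2 | h2 <;>
      rw [hek, simple_mul_simple_cancel_right] at h2 <;> rw [hek] at hi <;> omega
  · rw [List.eraseIdx_append_of_length_le le_rfl] at hek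
    simp only [Nat.sub_self, List.eraseIdx_cons_zero, List.append_nil] at hek
    rw [← hw, mul_right_inj] at hek
    exact absurd (cs.simple_injective hek) hij

theorem length_simple_conj_add_two {w : W} {i : B} (hl : cs.IsLeftDescent w i)
    (hr : cs.IsRightDescent w i) (hc : cs.simple i * w * cs.simple i ≠ w) :
    cs.length (cs.simple i * w * cs.simple i) + 2 = cs.length w := by
  rw [isLeftDescent_iff] at hl
  rw [isRightDescent_iff] at hr
  rcases cs.length_mul_simple (cs.simple i * w) i with h | h
  · refine absurd ?_ hc
    have := cs.simple_mul_eq_mul_simple (w := cs.simple i * w) (i := i) (j := i)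
      (by rw [not_isLeftDescent_iff, simple_mul_simple_cancel_left, hl])
      (by rw [not_isRightDescent_iff, h])
      (by rw [simple_mul_simple_cancel_left]; omega)
    rw [← this, simple_mul_simple_cancel_left]
  · omega

/-! ### Commuting with all products of two simple reflections -/

theorem not_isRightDescent_of_commute {w : W} {i j : B} (hij : i ≠ j)
    (hc : Commute w (cs.simple i * cs.simple j)) (hi : cs.IsRightDescent w i)
    (hj : ¬ cs.IsLeftDescent w j) : ¬ cs.IsRightDescent w j := by
  intro hr
  have h := cs.length_mul_simple_mul_simple hij hi hr
  rw [mul_assoc, hc.eq, mul_assoc] at h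
  rw [not_isLeftDescent_iff] at hj
  rcases cs.length_simple_mul (cs.simple j * w) i with h' | h' <;> omega

theorem commute_simple_of_commute_mul (hB : 3 ≤ ENat.card B) {z : W}
    (hz : ∀ i j, Commute z (cs.simple i * cs.simple j)) (i : B) : Commute z (cs.simple i) := by
  by_contra hi
  have hconj : ∀ j, cs.simple j * z * cs.simple j = cs.simple i * z * cs.simple i := fun j => by
    have h := congrArg (fun x => cs.simple j * x * cs.simple i) (hz j i).eq
    simpa [mul_assoc] using h
  have hne : cs.simple i * z * cs.simple i ≠ z := fun h => hi <| by
    have h' := congrArg (fun x => x * cs.simple i) h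
    simpa [commute_iff_eq] using h'.symm
  generalize cs.simple i * z * cs.simple i = z' at hconj hne
  have hz1 : z ≠ 1 := by
    rintro rfl
    exact hi (Commute.one_left _)
  have hneither : ∀ j, ¬ cs.IsLeftDescent z j → ¬ cs.IsRightDescent z j →
      cs.length z' = cs.length z + 2 := fun j hl hr => by
    by_contra h
    rw [← hconj j] at h hne
    refine hne ?_
    rw [cs.simple_mul_eq_mul_simple hl hr h, simple_mul_simple_cancel_right]
  have hboth : ∀ j, cs.IsLeftDescent z j → cs.IsRightDescent z j →
      cs.length z' + 2 = cs.length z := fun j hl hr => by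
    rw [← hconj j] at hne ⊢
    exact cs.length_simple_conj_add_two hl hr hne
  have hlen : ∀ j, (cs.length (cs.simple j * z) = cs.length (z' * cs.simple j)) ∧
      (cs.length (z * cs.simple j) = cs.length (cs.simple j * z')) := fun j => by
    rw [← hconj j]
    simp [mul_assoc]
  have hone : ∀ j, cs.IsLeftDescent z j ↔ ¬ cs.IsRightDescent z j := by
    intro j
    by_cases hl : cs.IsLeftDescent z j <;> by_cases hr : cs.IsRightDescent z j <;>
      simp only [hl, hr, not_true_eq_false, not_false_eq_true, iff_true, iff_false, iff_self]
    · have h := hboth j hl hr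
      have hz' : z' ≠ 1 := by
        rintro rfl
        apply hz1
        have := congrArg (fun x => cs.simple j * x * cs.simple j) (hconj j)
        simpa [mul_assoc] using this
      obtain ⟨k, hk⟩ := cs.exists_rightDescent_of_ne_one hz'
      -- Here `s_k z` has the length of `z' s_k`, namely `ℓ(z) - 3`, which is impossible.
      have h1 := (cs.isRightDescent_iff).mp hk
      rw [← (hlen k).1] at h1
      rcases cs.length_simple_mul z k with h2 | h2 <;> omega
    · have h := hneither j hl hr
      obtain ⟨k, hk⟩ := cs.exists_rightDescent_of_ne_one hz1
      have h1 := (cs.isRightDescent_iff).mp hk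
      rw [(hlen k).2] at h1
      rcases cs.length_simple_mul z' k with h2 | h2 <;> omega
  -- Pigeonhole: an index is determined by the side on which it is a descent.
  have hinj : Function.Injective fun j => (⟨cs.IsRightDescent z j⟩ : ULift.{0} Prop) := by
    intro j k hjk
    replace hjk : cs.IsRightDescent z j ↔ cs.IsRightDescent z k := by simpa using hjk
    by_contra hne
    by_cases hr : cs.IsRightDescent z j
    · exact cs.not_isRightDescent_of_commute hne (hz j k) hr
        (by rw [hone, not_not]; exact hjk.mp hr) (hjk.mp hr)
    · have hr' := mt hjk.mpr hr
      have hl := (hone j).mpr hr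
      have hl' := (hone k).mpr hr'
      rw [← isRightDescent_inv_iff] at hl hl'
      exact cs.not_isRightDescent_of_commute hne (hz j k).inv_left hl
        (by rwa [isLeftDescent_inv_iff]) hl'
  have hcard := ENat.card_le_card_of_injective hinj
  have : ENat.card (ULift.{0} Prop) = 2 := by simp
  rw [this] at hcard
  exact absurd (hB.trans hcard) (by decide)

/-! ### Central elements of `W` -/

theorem mem_center_of_commute_simple {z : W} (hz : ∀ i, Commute z (cs.simple i)) :
    z ∈ Subgroup.center W := by
  rw [Subgroup.mem_center_iff]
  intro w
  induction w using cs.simple_induction with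
  | simple i => exact (hz i).eq.symm
  | one => simp
  | mul w w' h h' => rw [mul_assoc, h', ← mul_assoc, h, mul_assoc]

/-- Compare the cocycle identity for `z x` and for `x z`. -/
theorem inversionParity_conj {z : W} (hz : z ∈ Subgroup.center W) (x t : W) :
    cs.inversionParity z (x * t * x⁻¹) = cs.inversionParity z t := by
  have hc := Subgroup.mem_center_iff.mp hz
  have h := cs.inversionParity_mul z x t
  rw [← hc x, inversionParity_mul, ← hc t, mul_inv_cancel_right, add_comm] at h
  exact (add_left_cancel h).symm

/-- Otherwise `z s_j` has both descents `i` and `j`, so `z s_j s_i` has descent `j`. As `s_i s_j s_i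
≠ s_j`, the cocycle reduces its parity at `s_j` to that of `z`. -/
theorem isRightDescent_of_adj {z : W} (hz : z ∈ Subgroup.center W) {i j : B}
    (hij : M.coxeterGraph.Adj i j) (hi : cs.IsRightDescent z i) : cs.IsRightDescent z j := by
  classical
  by_contra hj
  have hne : cs.simple j ≠ cs.simple i := cs.simple_injective.ne hij.1.symm
  have hj' : cs.IsRightDescent (z * cs.simple j) j := by
    rw [isRightDescent_iff_not_isRightDescent_mul, simple_mul_simple_cancel_right]
    exact hj
  have hi' : cs.IsRightDescent (z * cs.simple j) i := by
    rw [← inversionParity_simple_eq_one_iff, inversionParity_mul, inversionParity_conj cs hz,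
      inversionParity_simple, if_neg hne.symm, zero_add, inversionParity_simple_eq_one_iff]
    exact hi
  have hlen := cs.length_mul_simple_mul_simple hij.1 hi' hj'
  rw [isRightDescent_iff] at hi'
  have hd : cs.IsRightDescent (z * cs.simple j * cs.simple i) j := by
    rw [isRightDescent_iff]
    omega
  rw [← inversionParity_simple_eq_one_iff, mul_assoc, inversionParity_mul,
    inversionParity_conj cs hz, inversionParity_mul, inversionParity_simple,
    inversionParity_simple, if_neg hne, zero_add] at hd
  split_ifs at hd with h
  · refine hij.2 (cs.eq_two_of_commute_simple hij.1 ?_)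
    have := congrArg (fun x => x * cs.simple i) h
    simpa [commute_iff_eq] using this
  · rw [zero_add, inversionParity_simple_eq_one_iff] at hd
    exact hj hd

/-- If `w = v s_i` is longer than `v`, then `v` has parity 0 at `s_i`, so `z v` has the parity of
`z` there, which is 1: lengthening `v` shortens `z v`. -/
theorem length_mul_add_length_of_forall_isRightDescent {z : W} (hz : z ∈ Subgroup.center W)
    (hd : ∀ i, cs.IsRightDescent z i) (w : W) :
    cs.length (z * w) + cs.length w = cs.length z := by
  induction hn : cs.length w generalizing w with
  | zero => simp [cs.length_eq_zero_iff.mp hn]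
  | succ n ih =>
    obtain ⟨i, hi⟩ := cs.exists_rightDescent_of_ne_one
      (w := w) (by rintro rfl; simp at hn)
    have hv : cs.length (w * cs.simple i) = n := by
      rw [isRightDescent_iff] at hi
      omega
    have h := ih _ hv
    have hp : cs.inversionParity (w * cs.simple i) (cs.simple i) = 0 := by
      have h1 := mt (cs.inversionParity_simple_eq_one_iff _ i).mp
        (cs.isRightDescent_iff_not_isRightDescent_mul.mp hi)
      generalize cs.inversionParity (w * cs.simple i) (cs.simple i) = a at h1
      revert a
      decide
    have h2 : cs.IsRightDescent (z * (w * cs.simple i)) i := by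
      rw [← inversionParity_simple_eq_one_iff, inversionParity_mul, inversionParity_conj cs hz,
        hp, zero_add, inversionParity_simple_eq_one_iff]
      exact hd i
    rw [isRightDescent_iff, ← mul_assoc, simple_mul_simple_cancel_right, mul_assoc] at h2
    omega

/-- One finite inversion sequence contains all simple reflections, so `B` is finite, and `ℓ(z)`
bounds all lengths. -/
theorem finite_of_forall_isRightDescent {z : W} (hz : z ∈ Subgroup.center W)
    (hd : ∀ i, cs.IsRightDescent z i) : Finite W := by
  obtain ⟨ω, -, rfl⟩ := cs.exists_isReduced z
  have := (Multiset.finite_toSet (Multiset.ofList <| cs.rightInvSeq ω)).to_subtype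
  have : Finite B := Finite.of_injective
    (fun i => (⟨cs.simple i, Multiset.mem_coe.mpr ((hd i).mem_rightInvSeq cs)⟩ :
      ({t | t ∈ Multiset.ofList (cs.rightInvSeq ω)} : Set W)))
    fun i j h => cs.simple_injective (congrArg Subtype.val h)
  have := (List.finite_length_le B (cs.length (cs.wordProd ω))).to_subtype
  refine Finite.of_surjective
    (fun l : {l : List B | l.length ≤ cs.length (cs.wordProd ω)} => cs.wordProd l.1) fun w => ?_
  obtain ⟨l, hl, rfl⟩ := cs.exists_isReduced w
  refine ⟨⟨l, ?_⟩, rfl⟩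
  have := cs.length_mul_add_length_of_forall_isRightDescent hz hd (cs.wordProd l)
  rw [hl.eq] at this
  exact Nat.le.intro ((add_comm _ _).trans this)

theorem center_eq_bot_of_isIrreducible (cs : CoxeterSystem M W) [Infinite W]
    (hM : M.IsIrreducible) :
    Subgroup.center W = ⊥ := by
  rw [Subgroup.eq_bot_iff_forall]
  intro z hz
  by_contra hz1
  obtain ⟨i, hi⟩ := cs.exists_rightDescent_of_ne_one hz1
  refine not_finite_iff_infinite.mpr ‹_› (cs.finite_of_forall_isRightDescent hz fun j => ?_)
  obtain ⟨p⟩ := hM.preconnected i j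
  induction p with
  | nil => exact hi
  | cons h _ ih => exact ih (cs.isRightDescent_of_adj hz h hi)

theorem simple_mul_simple_mem_alternatingSubgroup (i j : B) :
    cs.simple i * cs.simple j ∈ cs.alternatingSubgroup := by
  have h := cs.length_mul_mod_two (cs.simple i) (cs.simple j)
  rw [length_simple, length_simple] at h
  exact Nat.even_iff.mpr h

theorem map_center_alternatingSubgroup_le (hB : 3 ≤ ENat.card B) :
    (Subgroup.center cs.alternatingSubgroup).map cs.alternatingSubgroup.subtype ≤
      Subgroup.center W := by
  rintro _ ⟨z, hz, rfl⟩
  refine cs.mem_center_of_commute_simple (cs.commute_simple_of_commute_mul hB fun i j => ?_)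
  exact (congrArg Subtype.val (Subgroup.mem_center_iff.mp hz
    ⟨_, cs.simple_mul_simple_mem_alternatingSubgroup i j⟩)).symm

end CoxeterSystem

theorem proposition3 {B W : Type*} [Group W] {M : CoxeterMatrix B} (cs : CoxeterSystem M W)
    (hB : 3 ≤ ENat.card B) :
    (Subgroup.center cs.alternatingSubgroup).map cs.alternatingSubgroup.subtype ≤
        Subgroup.center W ∧
      (Infinite W → M.IsIrreducible → Subgroup.center cs.alternatingSubgroup = ⊥) := by
  refine ⟨cs.map_center_alternatingSubgroup_le hB, fun _ hM => ?_⟩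
  have h := cs.map_center_alternatingSubgroup_le hB
  rw [cs.center_eq_bot_of_isIrreducible hM, le_bot_iff] at h
  exact (Subgroup.map_eq_bot_iff_of_injective _ (Subgroup.subtype_injective _)).mp h
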